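/- Let $\beta>1$ be a real number and let $T_\beta x=\beta x-\lfloor \beta x\rfloor$ be the $\beta$-transformation on $[0,1]$. The $\beta$-expansion of $x$ has digits $\varepsilon_{n}(x)=\lfloor \beta\, T_\beta^{n-1}x\rfloor$ $(n\ge 1)$; it is called infinite if $\varepsilon_n(x)\neq 0$ for infinitely many $n$. Then for Lebesgue-almost every $x\in[0,1)$, \[ \liminf_{n\to\infty}\frac{\log T_\beta^n x}{\log n}=-1 . \] Moreover, for every $x\in[0,1)$ whose $\beta$-expansion is infinite, \[ \limsup_{n\to\infty}\frac{\log T_\beta^n x}{\log n}=0 . \] -/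

import Mathlib

open Filter MeasureTheory

noncomputable section

/-- The `β`-transformation `T_β x = β x - ⌊β x⌋`. -/
def betaT (β x : ℝ) : ℝ := β * x - (⌊β * x⌋ : ℝ)

/-- The digits of the `β`-expansion of `x`, indexed from `0`:
`betaDigit β x n = ⌊β T_β^n x⌋` is the `(n+1)`-st digit of `x`. -/
def betaDigit (β x : ℝ) (n : ℕ) : ℤ := ⌊β * (betaT β)^[n] x⌋

/-- The `β`-expansion of `x` is finite if its digits vanish from some index on. -/
def HasFiniteBetaExpansion (β x : ℝ) : Prop :=
  ∃ n₀ : ℕ, ∀ n ≥ n₀, betaDigit β x n = 0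

/-- The `β`-expansion of `x` is infinite if it is not finite. -/
def HasInfiniteBetaExpansion (β x : ℝ) : Prop := ¬ HasFiniteBetaExpansion β x

/-- The quantity `log (T_β^n x) / log n`, as an extended real, so that `liminf` and `limsup`
are taken in a complete lattice. (If `T_β^n x = 0` for some `n` then all later iterates
vanish and this sequence is eventually `0` by convention; this happens only for `x` in the
countable set of points with a finite expansion.) -/
def logOrbitRatio (β x : ℝ) (n : ℕ) : EReal :=
  ((Real.log ((betaT β)^[n] x) / Real.log (n : ℝ) : ℝ) : EReal)

end

open Filter MeasureTheory

/-! Splitting `[0, a)` into the branches of `T_β` gives a recursion in `a` for the measure of `[0,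
a) ∩ T_β⁻ⁿ B`; no invariant density is needed. It shows that `T_β⁻ⁿ [0, r)` has measure at most `C
r` in `[0, 1)`, uniformly in `n`, so Borel–Cantelli with `r = n⁻ᶜ`, `c > 1`, gives `liminf ≥ -1`.

For `liminf ≤ -1`, independence is replaced by a product bound
(`volume_real_Ico_inter_avoidSet_le`): missing the targets `[0, β^(-k i))` at times spaced by the `k
i` has measure at most `∏ (1 - β^(-k i))`, which tends to `0` when `∑ β^(-k i)` diverges. With `k j
≈ log_β (j + 2)` the series is harmonic up to constants, while the `j`-th time is `O(j^(1 + δ))`, so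
the orbit falls below roughly `1/n` infinitely often.

The limsup is elementary: a nonzero digit forces `T_βⁿ x ≥ 1/β`. -/

lemma betaT_eq_fract (β x : ℝ) : betaT β x = Int.fract (β * x) := rfl

lemma betaT_nonneg (β x : ℝ) : 0 ≤ betaT β x := Int.fract_nonneg _

lemma betaT_lt_one (β x : ℝ) : betaT β x < 1 := Int.fract_lt_one _

lemma betaT_zero (β : ℝ) : betaT β 0 = 0 := by simp [betaT]

lemma measurable_betaT (β : ℝ) : Measurable (betaT β) :=
  measurable_fract.comp (measurable_const.mul measurable_id)

lemma iterate_betaT_mem_Ico (β : ℝ) {x : ℝ} (hx : x ∈ Set.Ico (0 : ℝ) 1) (n : ℕ) :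
    (betaT β)^[n] x ∈ Set.Ico (0 : ℝ) 1 := by
  cases n with
  | zero => exact hx
  | succ n =>
    rw [Function.iterate_succ_apply']
    exact ⟨betaT_nonneg _ _, betaT_lt_one _ _⟩

/-! ### Measure of preimages under the branches -/

lemma volume_Ico_inter_ne_top (a b : ℝ) (B : Set ℝ) : volume (Set.Ico a b ∩ B) ≠ ⊤ :=
  measure_ne_top_of_subset Set.inter_subset_left (by simp)

lemma volume_real_Ico_inter_fract {B : Set ℝ} (hB : MeasurableSet B) {t : ℝ}
    (ht : t ∈ Set.Ico (0 : ℝ) 1) (d : ℕ) :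
    volume.real (Set.Ico 0 (d + t) ∩ Int.fract ⁻¹' B) =
      d * volume.real (Set.Ico 0 1 ∩ B) + volume.real (Set.Ico 0 t ∩ B) := by
  have hfr : MeasurableSet ((Int.fract : ℝ → ℝ) ⁻¹' B) := measurable_fract hB
  have key : ∀ u ∈ Set.Icc (0 : ℝ) 1,
      Set.Ico 0 u ∩ Int.fract ⁻¹' B = Set.Ico 0 u ∩ B := by
    intro u hu
    ext y
    simp only [Set.mem_inter_iff, Set.mem_preimage, and_congr_right_iff]
    intro hy
    rw [Int.fract_eq_self.2 ⟨hy.1, hy.2.trans_le hu.2⟩]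
  induction d with
  | zero => simp [key t ⟨ht.1, ht.2.le⟩]
  | succ d ih =>
    have hd : (0 : ℝ) ≤ d + t := add_nonneg d.cast_nonneg ht.1
    have hsplit : Set.Ico (0 : ℝ) ((d + 1 : ℕ) + t) ∩ Int.fract ⁻¹' B =
        (Set.Ico 0 1 ∩ Int.fract ⁻¹' B) ∪ (Set.Ico 1 (d + t + 1) ∩ Int.fract ⁻¹' B) := by
      rw [← Set.union_inter_distrib_right, Set.Ico_union_Ico_eq_Ico zero_le_one (by linarith)]
      congr 2
      push_cast
      ring
    have htrans : Set.Ico (0 : ℝ) (d + t) ∩ Int.fract ⁻¹' B =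
        (fun y => y + 1) ⁻¹' (Set.Ico 1 (d + t + 1) ∩ Int.fract ⁻¹' B) := by
      ext y
      simp [Int.fract_add_one]
    rw [hsplit, measureReal_union _ (measurableSet_Ico.inter hfr)
      (volume_Ico_inter_ne_top _ _ _) (volume_Ico_inter_ne_top _ _ _),
      key 1 ⟨zero_le_one, le_rfl⟩]
    · have : volume.real (Set.Ico 1 (d + t + 1) ∩ Int.fract ⁻¹' B) =
          volume.real (Set.Ico (0 : ℝ) (d + t) ∩ Int.fract ⁻¹' B) := by
        rw [htrans, measureReal_def, measureReal_def, measure_preimage_add_right]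
      rw [this, ih]
      push_cast
      ring
    · refine Set.disjoint_left.2 fun y hy hy' => ?_
      exact absurd hy.1.2 (not_lt.2 hy'.1.1)

lemma natFloor_add_betaT {β a : ℝ} (hβ : 0 ≤ β) (ha : 0 ≤ a) :
    (⌊β * a⌋₊ : ℝ) + betaT β a = β * a := by
  rw [betaT, natCast_floor_eq_intCast_floor (mul_nonneg hβ ha)]
  ring

/-- The branches of `T_β` meeting `[0, a)` are `⌊β a⌋` full ones and one with image `[0, T_β a)`. -/
lemma volume_real_Ico_inter_preimage_betaT {β : ℝ} (hβ : 0 < β) {B : Set ℝ}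
    (hB : MeasurableSet B) {a : ℝ} (ha : 0 ≤ a) :
    volume.real (Set.Ico 0 a ∩ betaT β ⁻¹' B) =
      (⌊β * a⌋₊ * volume.real (Set.Ico 0 1 ∩ B) +
        volume.real (Set.Ico 0 (betaT β a) ∩ B)) / β := by
  have hset : Set.Ico 0 a ∩ betaT β ⁻¹' B =
      (fun y => β * y) ⁻¹' (Set.Ico 0 (β * a) ∩ Int.fract ⁻¹' B) := by
    ext y
    simp [betaT_eq_fract, hβ, mul_div_cancel_left₀ a hβ.ne']
  rw [hset, measureReal_def, Real.volume_preimage_mul_left hβ.ne', ENNReal.toReal_mul,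
    ENNReal.toReal_ofReal (abs_nonneg _), abs_of_pos (inv_pos.2 hβ), ← measureReal_def]
  conv_lhs => rw [← natFloor_add_betaT hβ.le ha]
  rw [volume_real_Ico_inter_fract hB ⟨betaT_nonneg _ _, betaT_lt_one _ _⟩]
  ring

lemma volume_real_Ico_inter_preimage_iterate_succ {β : ℝ} (hβ : 0 < β) {B : Set ℝ}
    (hB : MeasurableSet B) {a : ℝ} (ha : 0 ≤ a) (n : ℕ) :
    volume.real (Set.Ico 0 a ∩ (betaT β)^[n + 1] ⁻¹' B) =
      (⌊β * a⌋₊ * volume.real (Set.Ico 0 1 ∩ (betaT β)^[n] ⁻¹' B) +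
        volume.real (Set.Ico 0 (betaT β a) ∩ (betaT β)^[n] ⁻¹' B)) / β := by
  rw [Function.iterate_succ, Set.preimage_comp]
  exact volume_real_Ico_inter_preimage_betaT hβ ((measurable_betaT β).iterate n hB) ha

/-- The coefficient of `a` is `r ∑_{i<n} β⁻ⁱ`. In the recursion each full branch adds an error `β⁻ⁿ
r`, which the factor `a` absorbs because there are at most `β a` of them; the partial branch leaves
the additive term. -/
lemma volume_real_preimage_iterate_le_aux {β : ℝ} (hβ : 1 < β) {r : ℝ} (hr : 0 ≤ r) (n : ℕ) :
    ∀ a ∈ Set.Icc (0 : ℝ) 1,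
      volume.real (Set.Ico 0 a ∩ (betaT β)^[n] ⁻¹' Set.Ico 0 r) ≤
        a * (β / (β - 1) * r * (1 - (β⁻¹) ^ n)) + (β⁻¹) ^ n * r := by
  have hβ0 : 0 < β := by linarith
  have hβ1 : 0 < β - 1 := by linarith
  induction n with
  | zero =>
    intro a ha
    have : volume.real (Set.Ico 0 a ∩ Set.Ico 0 r) ≤ volume.real (Set.Ico 0 r) :=
      measureReal_mono Set.inter_subset_right (by simp)
    simpa [Real.volume_real_Ico, hr] using this
  | succ n ih =>
    intro a ha
    rw [volume_real_Ico_inter_preimage_iterate_succ hβ0 measurableSet_Ico ha.1]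
    have h1 := ih 1 ⟨zero_le_one, le_rfl⟩
    have h2 := ih (betaT β a) ⟨betaT_nonneg _ _, (betaT_lt_one _ _).le⟩
    have hfl := natFloor_add_betaT hβ0.le ha.1
    have hd : (0 : ℝ) ≤ ⌊β * a⌋₊ := Nat.cast_nonneg _
    have ht := betaT_nonneg β a
    set d : ℝ := (⌊β * a⌋₊ : ℝ)
    set t := betaT β a
    set q := (β⁻¹) ^ n
    have hq : 0 ≤ q := by positivity
    have e1 : β / (β - 1) * r * (1 - β⁻¹ ^ (n + 1)) = β / (β - 1) * r * (1 - q) + q * r := by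
      rw [pow_succ]
      field_simp
      ring
    have e2 : (β⁻¹) ^ (n + 1) * r = q * r / β := by
      rw [pow_succ]
      field_simp
      ring
    rw [e1, e2, div_le_iff₀ hβ0]
    set M := β / (β - 1) * r * (1 - q)
    have e3 : (a * (M + q * r) + q * r / β) * β = (d + t) * (M + q * r) + q * r := by
      rw [hfl]
      field_simp
    rw [e3]
    nlinarith [mul_le_mul_of_nonneg_left h1 hd, mul_nonneg ht (mul_nonneg hq hr)]

lemma volume_real_preimage_iterate_le {β : ℝ} (hβ : 1 < β) {r : ℝ} (hr : 0 ≤ r) (n : ℕ) :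
    volume.real (Set.Ico 0 1 ∩ (betaT β)^[n] ⁻¹' Set.Ico 0 r) ≤ (β / (β - 1) + 1) * r := by
  have h := volume_real_preimage_iterate_le_aux hβ hr n 1 ⟨zero_le_one, le_rfl⟩
  have hq0 : 0 ≤ (β⁻¹) ^ n := by positivity
  have hq1 : (β⁻¹) ^ n ≤ 1 := pow_le_one₀ (by positivity) (inv_le_one_of_one_le₀ hβ.le)
  have hC : 0 ≤ β / (β - 1) * r := mul_nonneg (div_nonneg (by linarith) (by linarith)) hr
  nlinarith [mul_nonneg hC hq0, mul_nonneg hr (sub_nonneg.2 hq1)]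

lemma ae_eventually_rpow_le_iterate_betaT {β : ℝ} (hβ : 1 < β) {c : ℝ} (hc : 1 < c) :
    ∀ᵐ x ∂(volume.restrict (Set.Ico (0 : ℝ) 1)),
      ∀ᶠ n : ℕ in atTop, (n : ℝ) ^ (-c) ≤ (betaT β)^[n] x := by
  have hsum : ∑' n : ℕ, (volume.restrict (Set.Ico (0 : ℝ) 1))
      ((betaT β)^[n] ⁻¹' Set.Ico 0 ((n : ℝ) ^ (-c))) ≠ ⊤ := by
    have hs : Summable fun n : ℕ => (β / (β - 1) + 1) * (n : ℝ) ^ (-c) :=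
      (Real.summable_nat_rpow.2 (by linarith)).mul_left _
    refine ne_top_of_le_ne_top hs.tsum_ofReal_ne_top (ENNReal.tsum_le_tsum fun n => ?_)
    rw [Measure.restrict_apply ((measurable_betaT β).iterate n measurableSet_Ico),
      Set.inter_comm, ← ofReal_measureReal (volume_Ico_inter_ne_top _ _ _)]
    exact ENNReal.ofReal_le_ofReal (volume_real_preimage_iterate_le hβ (by positivity) n)
  filter_upwards [ae_eventually_notMem hsum, ae_restrict_mem measurableSet_Ico] with x hx hx01
  filter_upwards [hx] with n hn
  by_contra! hlt
  exact hn ⟨(iterate_betaT_mem_Ico β hx01 n).1, hlt⟩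

/-! ### Avoiding shrinking targets along a sequence of times -/

/-- The points whose orbit avoids `[0, β⁻ᵏ⁽ⁱ⁾)` at time `k 0 + ⋯ + k (i - 1)`, for all `i < m`. -/
def avoidSet (β : ℝ) : ℕ → (ℕ → ℕ) → Set ℝ
  | 0, _ => Set.univ
  | m + 1, k => Set.Ici ((β⁻¹) ^ k 0) ∩ (betaT β)^[k 0] ⁻¹' avoidSet β m (fun i => k (i + 1))

lemma measurableSet_avoidSet (β : ℝ) (m : ℕ) : ∀ k, MeasurableSet (avoidSet β m k) := by
  induction m with
  | zero => exact fun _ => MeasurableSet.univ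
  | succ m ih => exact fun k => measurableSet_Ici.inter ((measurable_betaT β).iterate _ (ih _))

lemma mem_avoidSet {β x : ℝ} (m : ℕ) : ∀ (k : ℕ → ℕ) (s : ℕ),
    (∀ i < m, (β⁻¹) ^ k i ≤ (betaT β)^[s + ∑ l ∈ Finset.range i, k l] x) →
      (betaT β)^[s] x ∈ avoidSet β m k := by
  induction m with
  | zero => exact fun _ _ _ => Set.mem_univ _
  | succ m ih =>
    intro k s h
    refine ⟨by simpa using h 0 (Nat.succ_pos _), ?_⟩
    rw [Set.mem_preimage, ← Function.iterate_add_apply, Nat.add_comm]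
    refine ih _ _ fun i hi => ?_
    have := h (i + 1) (Nat.succ_lt_succ hi)
    rwa [Finset.sum_range_succ', Nat.add_comm _ (k 0), ← Nat.add_assoc] at this

/-- A bound linear in `a` passes through the recursion because `⌊β a⌋ + T_β a = β a`. It must hold
for every `a`, since partial branches produce arbitrary endpoints. -/
lemma volume_real_preimage_iterate_le_of_forall {β : ℝ} (hβ : 0 < β) {B : Set ℝ}
    (hB : MeasurableSet B) {P : ℝ}
    (h : ∀ a ∈ Set.Icc (0 : ℝ) 1, volume.real (Set.Ico 0 a ∩ B) ≤ a * P) (n : ℕ) :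
    ∀ a ∈ Set.Icc (0 : ℝ) 1,
      volume.real (Set.Ico 0 a ∩ (betaT β)^[n] ⁻¹' B) ≤ a * P := by
  induction n with
  | zero => simpa using h
  | succ n ih =>
    intro a ha
    rw [volume_real_Ico_inter_preimage_iterate_succ hβ hB ha.1, div_le_iff₀ hβ]
    have h1 := ih 1 ⟨zero_le_one, le_rfl⟩
    have h2 := ih (betaT β a) ⟨betaT_nonneg _ _, (betaT_lt_one _ _).le⟩
    have hfl := natFloor_add_betaT hβ.le ha.1
    have hd : (0 : ℝ) ≤ ⌊β * a⌋₊ := Nat.cast_nonneg _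
    have e : a * P * β = (⌊β * a⌋₊ + betaT β a) * P := by rw [hfl]; ring
    rw [e]
    nlinarith [mul_le_mul_of_nonneg_left h1 hd]

/-- This is the gain behind each factor `1 - β⁻ⁿ`: `[0, β⁻ⁿ)` is the leftmost full branch of `T_βⁿ`,
and removing it does not spoil the linear bound on the rest. -/
lemma volume_real_preimage_iterate_sub_le {β : ℝ} (hβ : 1 < β) {B : Set ℝ}
    (hB : MeasurableSet B) {P : ℝ}
    (h : ∀ a ∈ Set.Icc (0 : ℝ) 1, volume.real (Set.Ico 0 a ∩ B) ≤ a * P) (n : ℕ) :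
    ∀ a ∈ Set.Icc ((β⁻¹) ^ n) 1,
      volume.real (Set.Ico 0 a ∩ (betaT β)^[n] ⁻¹' B) -
        volume.real (Set.Ico 0 ((β⁻¹) ^ n) ∩ (betaT β)^[n] ⁻¹' B) ≤ (a - (β⁻¹) ^ n) * P := by
  have hβ0 : 0 < β := by linarith
  induction n with
  | zero =>
    intro a ha
    have : a = 1 := le_antisymm ha.2 (by simpa using ha.1)
    simp [this]
  | succ n ih =>
    intro a ha
    have hq1 : (β⁻¹) ^ n ≤ 1 := pow_le_one₀ (by positivity) (inv_le_one_of_one_le₀ hβ.le)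
    have hq0 : 0 < (β⁻¹) ^ n := by positivity
    have ha0 : 0 ≤ a := le_trans (by positivity) ha.1
    have hmul : β * (β⁻¹) ^ (n + 1) = (β⁻¹) ^ n := by
      rw [pow_succ]
      field_simp
    have hroot : volume.real (Set.Ico 0 ((β⁻¹) ^ (n + 1)) ∩ (betaT β)^[n + 1] ⁻¹' B) =
        volume.real (Set.Ico 0 ((β⁻¹) ^ n) ∩ (betaT β)^[n] ⁻¹' B) / β := by
      rw [volume_real_Ico_inter_preimage_iterate_succ hβ0 hB (by positivity), betaT_eq_fract, hmul]
      -- If `β⁻ⁿ = 1`, the interval is one full branch with empty remainder; otherwise it lies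
      -- inside the first branch.
      rcases hq1.lt_or_eq with hlt | heq
      · rw [Nat.floor_eq_zero.2 hlt, Int.fract_eq_self.2 ⟨hq0.le, hlt⟩]
        simp
      · simp [heq]
    rw [hroot, volume_real_Ico_inter_preimage_iterate_succ hβ0 hB ha0, ← sub_div,
      div_le_iff₀ hβ0]
    have hfl := natFloor_add_betaT hβ0.le ha0
    have e : (a - (β⁻¹) ^ (n + 1)) * P * β = (⌊β * a⌋₊ + betaT β a - (β⁻¹) ^ n) * P := by
      rw [hfl, ← hmul]
      ring
    rw [e]
    have hlow : (β⁻¹) ^ n ≤ β * a := by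
      rw [← hmul]
      exact mul_le_mul_of_nonneg_left ha.1 hβ0.le
    -- Without a full branch the partial one contains the removed interval. Otherwise the first full
    -- branch absorbs the subtraction, and the others obey the plain linear bound.
    rcases Nat.eq_zero_or_pos ⌊β * a⌋₊ with h0 | hpos
    · rw [h0] at hfl ⊢
      have hfl' : betaT β a = β * a := by simpa using hfl
      have := ih (betaT β a) ⟨hfl' ▸ hlow, (betaT_lt_one _ _).le⟩
      simpa using this
    · have hd : (1 : ℝ) ≤ ⌊β * a⌋₊ := by exact_mod_cast hpos
      have h1 := ih 1 ⟨hq1, le_rfl⟩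
      have h2 := volume_real_preimage_iterate_le_of_forall hβ0 hB h n 1 ⟨zero_le_one, le_rfl⟩
      have h3 := volume_real_preimage_iterate_le_of_forall hβ0 hB h n (betaT β a)
        ⟨betaT_nonneg _ _, (betaT_lt_one _ _).le⟩
      nlinarith [mul_le_mul_of_nonneg_left h2 (sub_nonneg.2 hd)]

lemma volume_real_Ico_inter_avoidSet_le {β : ℝ} (hβ : 1 < β) (m : ℕ) : ∀ k : ℕ → ℕ,
    ∀ a ∈ Set.Icc (0 : ℝ) 1, volume.real (Set.Ico 0 a ∩ avoidSet β m k) ≤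
      a * ∏ i ∈ Finset.range m, (1 - (β⁻¹) ^ k i) := by
  have hq0 : ∀ n : ℕ, 0 < (β⁻¹) ^ n := fun n => by
    have : 0 < β := by linarith
    positivity
  have hq1 : ∀ n : ℕ, (β⁻¹) ^ n ≤ 1 := fun n =>
    pow_le_one₀ (by have : 0 < β := by linarith
                    positivity) (inv_le_one_of_one_le₀ hβ.le)
  induction m with
  | zero =>
    intro k a ha
    simp [avoidSet, Real.volume_real_Ico, ha.1]
  | succ m ih =>
    intro k a ha
    rw [Finset.prod_range_succ']
    set P := ∏ i ∈ Finset.range m, (1 - (β⁻¹) ^ k (i + 1))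
    have hP : 0 ≤ P := Finset.prod_nonneg fun i _ => sub_nonneg.2 (hq1 _)
    set B := avoidSet β m (fun i => k (i + 1)) with hBdef
    have hB : MeasurableSet B := measurableSet_avoidSet β m _
    set q := (β⁻¹) ^ k 0 with hq
    rcases lt_or_ge a q with hlt | hge
    · have : Set.Ico 0 a ∩ avoidSet β (m + 1) k = ∅ := by
        refine Set.eq_empty_of_forall_notMem fun y hy => ?_
        exact absurd (hy.1.2.trans hlt) (not_lt.2 hy.2.1)
      rw [this]
      rw [measureReal_empty]
      exact mul_nonneg ha.1 (mul_nonneg hP (sub_nonneg.2 (hq1 (k 0))))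
    · have hsub := volume_real_preimage_iterate_sub_le hβ hB (ih fun i => k (i + 1)) (k 0) a
        ⟨hge, ha.2⟩
      have hset : Set.Ico 0 a ∩ (betaT β)^[k 0] ⁻¹' B =
          (Set.Ico 0 a ∩ avoidSet β (m + 1) k) ∪ (Set.Ico 0 q ∩ (betaT β)^[k 0] ⁻¹' B) := by
        ext y
        simp only [avoidSet, Set.mem_inter_iff, Set.mem_union, Set.mem_Ico, Set.mem_Ici,
          ← hq, ← hBdef]
        constructor
        · rintro ⟨⟨h0, h1⟩, h2⟩
          rcases lt_or_ge y q with h3 | h3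
          · exact Or.inr ⟨⟨h0, h3⟩, h2⟩
          · exact Or.inl ⟨⟨h0, h1⟩, h3, h2⟩
        · rintro (⟨h0, -, h2⟩ | ⟨⟨h0, h1⟩, h2⟩)
          · exact ⟨h0, h2⟩
          · exact ⟨⟨h0, h1.trans_le hge⟩, h2⟩
      have hdisj : Disjoint (Set.Ico 0 a ∩ avoidSet β (m + 1) k)
          (Set.Ico 0 q ∩ (betaT β)^[k 0] ⁻¹' B) :=
        Set.disjoint_left.2 fun y hy hy' => absurd hy'.1.2 (not_lt.2 hy.2.1)
      rw [hset, measureReal_union hdisj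
        (measurableSet_Ico.inter ((measurable_betaT β).iterate _ hB))
        (volume_Ico_inter_ne_top _ _ _) (volume_Ico_inter_ne_top _ _ _)] at hsub
      -- Here `a ≤ 1` is used: `a - q ≤ a (1 - q)`.
      have hmono : (a - q) * P ≤ a * (P * (1 - q)) := by
        nlinarith [mul_nonneg (mul_nonneg (hq0 (k 0)).le hP) (sub_nonneg.2 ha.2)]
      linarith

lemma ae_exists_iterate_betaT_lt {β : ℝ} (hβ : 1 < β) {k : ℕ → ℕ}
    (hk : ¬ Summable fun i => (β⁻¹) ^ k i) (s : ℕ) :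
    ∀ᵐ x ∂(volume.restrict (Set.Ico (0 : ℝ) 1)),
      ∃ i, (betaT β)^[s + ∑ l ∈ Finset.range i, k l] x < (β⁻¹) ^ k i := by
  have hβ0 : 0 < β := by linarith
  set S : Set ℝ := {x | ∀ i, (β⁻¹) ^ k i ≤ (betaT β)^[s + ∑ l ∈ Finset.range i, k l] x} with hS
  have hprod : Tendsto (fun m => ∏ i ∈ Finset.range m, (1 - (β⁻¹) ^ k i)) atTop (nhds 0) := by
    have hdiv := (not_summable_iff_tendsto_nat_atTop_of_nonneg
      (fun i => by positivity : ∀ i, 0 ≤ (β⁻¹) ^ k i)).1 hk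
    refine squeeze_zero (fun m => Finset.prod_nonneg fun i _ => sub_nonneg.2
      (pow_le_one₀ (by positivity) (inv_le_one_of_one_le₀ hβ.le))) (fun m => ?_)
      (Real.tendsto_exp_neg_atTop_nhds_zero.comp hdiv)
    rw [Function.comp_apply, ← Finset.sum_neg_distrib, Real.exp_sum]
    refine Finset.prod_le_prod (fun i _ => sub_nonneg.2
      (pow_le_one₀ (by positivity) (inv_le_one_of_one_le₀ hβ.le))) fun i _ => ?_
    exact Real.one_sub_le_exp_neg _
  have hzero : volume (Set.Ico 0 1 ∩ S) = 0 := by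
    have hle : volume.real (Set.Ico 0 1 ∩ S) ≤ 0 := by
      refine ge_of_tendsto' hprod fun m => ?_
      have hsub : Set.Ico 0 1 ∩ S ⊆ Set.Ico 0 1 ∩ (betaT β)^[s] ⁻¹' avoidSet β m k :=
        Set.inter_subset_inter_right _ fun x hx => mem_avoidSet m k s fun i _ => hx i
      refine (measureReal_mono hsub (volume_Ico_inter_ne_top _ _ _)).trans ?_
      simpa using volume_real_preimage_iterate_le_of_forall hβ0 (measurableSet_avoidSet β m k)
        (volume_real_Ico_inter_avoidSet_le hβ m k) s 1 ⟨zero_le_one, le_rfl⟩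
    exact (measureReal_eq_zero_iff (volume_Ico_inter_ne_top _ _ _)).1
      (le_antisymm hle measureReal_nonneg)
  rw [ae_restrict_iff' measurableSet_Ico]
  refine measure_mono_null (fun x hx => ?_) hzero
  simpa [hS, Set.mem_inter_iff, and_assoc] using hx

/-- Every tail of a divergent series diverges, so a hit occurs after each index. -/
lemma ae_frequently_iterate_betaT_lt {β : ℝ} (hβ : 1 < β) {k : ℕ → ℕ}
    (hk : ¬ Summable fun i => (β⁻¹) ^ k i) :
    ∀ᵐ x ∂(volume.restrict (Set.Ico (0 : ℝ) 1)),
      ∃ᶠ j in atTop, (betaT β)^[∑ l ∈ Finset.range j, k l] x < (β⁻¹) ^ k j := by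
  have h : ∀ j : ℕ, ∀ᵐ x ∂(volume.restrict (Set.Ico (0 : ℝ) 1)), ∃ i,
      (betaT β)^[∑ l ∈ Finset.range j, k l + ∑ l ∈ Finset.range i, k (l + j)] x <
        (β⁻¹) ^ k (i + j) := fun j =>
    ae_exists_iterate_betaT_lt hβ (k := fun i => k (i + j))
      (fun hs => hk ((summable_nat_add_iff j).1 hs)) _
  filter_upwards [ae_all_iff.2 h] with x hx
  refine frequently_atTop.2 fun j => ?_
  obtain ⟨i, hi⟩ := hx j
  refine ⟨i + j, Nat.le_add_left _ _, ?_⟩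
  rw [Nat.add_comm i j, Finset.sum_range_add]
  rw [Nat.add_comm i j] at hi
  simpa only [Nat.add_comm _ j] using hi

/-! ### Choice of the target sizes -/

/-- The number of zero digits required of the `j`-th block. -/
noncomputable def zeroRun (β : ℝ) (j : ℕ) : ℕ := ⌈Real.logb β (j + 2)⌉₊

lemma inv_pow_zeroRun_le {β : ℝ} (hβ : 1 < β) (j : ℕ) :
    (β⁻¹) ^ zeroRun β j ≤ ((j : ℝ) + 2)⁻¹ := by
  have hj : (0 : ℝ) < j + 2 := by positivity
  have h : (j : ℝ) + 2 ≤ β ^ zeroRun β j := by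
    rw [← Real.rpow_natCast, ← Real.logb_le_iff_le_rpow hβ hj]
    exact Nat.le_ceil _
  rw [inv_pow]
  exact inv_anti₀ hj h

lemma not_summable_inv_pow_zeroRun {β : ℝ} (hβ : 1 < β) :
    ¬ Summable fun j => (β⁻¹) ^ zeroRun β j := by
  have hβ0 : 0 < β := by linarith
  intro hs
  have h2 : Summable fun j : ℕ => ((j + 2 : ℕ) : ℝ)⁻¹ := by
    refine (hs.mul_left β).of_nonneg_of_le (fun j => by positivity) fun j => ?_
    have hj : (0 : ℝ) < j + 2 := by positivity
    have hlog : 0 ≤ Real.logb β (j + 2) :=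
      Real.logb_nonneg hβ (by linarith [(Nat.cast_nonneg j : (0 : ℝ) ≤ j)])
    have h : β ^ zeroRun β j ≤ β * (j + 2) := by
      rw [← Real.rpow_natCast, mul_comm β]
      calc β ^ (zeroRun β j : ℝ) ≤ β ^ (Real.logb β (j + 2) + 1) :=
            Real.rpow_le_rpow_of_exponent_le hβ.le (Nat.ceil_lt_add_one hlog).le
        _ = (j + 2) * β := by
            rw [Real.rpow_add hβ0, Real.rpow_one, Real.rpow_logb hβ0 hβ.ne' hj]
    rw [inv_pow, ← div_eq_mul_inv, le_div_iff₀ (by positivity)]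
    push_cast
    rw [inv_mul_le_iff₀ hj]
    linarith
  exact Real.not_summable_natCast_inv ((summable_nat_add_iff 2).1 h2)

lemma le_sum_zeroRun {β : ℝ} (hβ : 1 < β) (j : ℕ) : j ≤ ∑ l ∈ Finset.range j, zeroRun β l := by
  have : ∀ l, 1 ≤ zeroRun β l := fun l =>
    Nat.one_le_ceil_iff.2 (Real.logb_pos hβ (by linarith [(Nat.cast_nonneg l : (0 : ℝ) ≤ l)]))
  simpa using Finset.card_nsmul_le_sum (Finset.range j) (zeroRun β) 1 fun l _ => this l

lemma eventually_sum_zeroRun_le {β : ℝ} (hβ : 1 < β) {δ : ℝ} (hδ : 0 < δ) :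
    ∀ᶠ j : ℕ in atTop,
      ((∑ l ∈ Finset.range j, zeroRun β l : ℕ) : ℝ) ≤ ((j : ℝ) + 2) ^ (1 + δ) := by
  have hlim : Tendsto (fun j : ℕ => (j : ℝ) + 2) atTop atTop :=
    tendsto_natCast_atTop_atTop.atTop_add tendsto_const_nhds
  have hlb : 0 < Real.log β := Real.log_pos hβ
  have h1 := hlim.eventually ((isLittleO_log_rpow_atTop hδ).bound
    (show 0 < Real.log β / 2 by positivity))
  have h2 := hlim.eventually ((tendsto_rpow_atTop hδ).eventually_ge_atTop 2)
  filter_upwards [h1, h2] with j hj1 hj2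
  have hj : (0 : ℝ) < j + 2 := by positivity
  have hx : (0 : ℝ) < ((j : ℝ) + 2) ^ δ := by positivity
  rw [Real.norm_of_nonneg hx.le] at hj1
  have hlog := (le_abs_self _).trans hj1
  have hterm : ∀ l ∈ Finset.range j, (zeroRun β l : ℝ) ≤ ((j : ℝ) + 2) ^ δ := by
    intro l hl
    have hlj : (l : ℝ) ≤ j := by exact_mod_cast (Finset.mem_range.1 hl).le
    have hl0 : (0 : ℝ) ≤ l := l.cast_nonneg
    have h3 : (zeroRun β l : ℝ) ≤ Real.logb β (l + 2) + 1 :=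
      (Nat.ceil_lt_add_one (Real.logb_nonneg hβ (by linarith))).le
    have h4 : Real.logb β (l + 2) ≤ Real.logb β (j + 2) :=
      Real.logb_le_logb_of_le hβ (by positivity) (by linarith)
    have h5 : Real.logb β (j + 2) ≤ ((j : ℝ) + 2) ^ δ / 2 := by
      rw [Real.logb, div_le_iff₀ hlb]
      linarith
    linarith
  push_cast
  calc ∑ l ∈ Finset.range j, (zeroRun β l : ℝ) ≤ j * ((j : ℝ) + 2) ^ δ := by
        simpa using Finset.sum_le_card_nsmul _ _ _ hterm
    _ ≤ (j + 2) * ((j : ℝ) + 2) ^ δ := by nlinarith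
    _ = ((j : ℝ) + 2) ^ (1 + δ) := by rw [Real.rpow_add hj, Real.rpow_one]

/-! ### Passage to logarithms -/

lemma neg_one_le_liminf_logOrbitRatio {β x : ℝ}
    (h : ∀ m : ℕ, ∀ᶠ n : ℕ in atTop, (n : ℝ) ^ (-(1 + 1 / ((m : ℝ) + 1))) ≤ (betaT β)^[n] x) :
    -1 ≤ liminf (fun n : ℕ => logOrbitRatio β x n) atTop := by
  refine EReal.ge_of_forall_gt_iff_ge.1 fun z hz => ?_
  have hz' : z < -1 := EReal.coe_lt_coe_iff.1 (by simpa using hz)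
  obtain ⟨m, hm⟩ := exists_nat_one_div_lt (show 0 < -1 - z by linarith)
  refine le_liminf_of_le (by isBoundedDefault) ?_
  filter_upwards [h m, eventually_ge_atTop 2] with n hn hn2
  have hn2' : (2 : ℝ) ≤ n := by exact_mod_cast hn2
  have hn0 : (0 : ℝ) < n := by linarith
  have hlogn : 0 < Real.log n := Real.log_pos (by linarith)
  have hlog := Real.log_le_log (by positivity) hn
  rw [Real.log_rpow hn0] at hlog
  rw [logOrbitRatio, EReal.coe_le_coe_iff, le_div_iff₀ hlogn]
  refine le_trans ?_ hlog
  exact mul_le_mul_of_nonneg_right (by linarith) hlogn.le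

lemma liminf_logOrbitRatio_le_neg_one {β : ℝ} (hβ : 1 < β) {x : ℝ}
    (hpos : ∀ᶠ n : ℕ in atTop, 0 < (betaT β)^[n] x)
    (h : ∃ᶠ j in atTop,
      (betaT β)^[∑ l ∈ Finset.range j, zeroRun β l] x < (β⁻¹) ^ zeroRun β j) :
    liminf (fun n : ℕ => logOrbitRatio β x n) atTop ≤ -1 := by
  refine EReal.le_of_forall_lt_iff_le.1 fun z hz => ?_
  have hz' : -1 < z := EReal.coe_lt_coe_iff.1 (by simpa using hz)
  obtain ⟨δ, hδ, hδz⟩ : ∃ δ : ℝ, 0 < δ ∧ -1 ≤ z * (1 + δ) := by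
    rcases le_or_gt 0 z with h0 | h0
    · exact ⟨1, one_pos, by linarith⟩
    -- With `δ = 1 + z`, `z (1 + δ) = (1 + z)² - 1 ≥ -1`.
    · exact ⟨1 + z, by linarith, by nlinarith [mul_pos_of_neg_of_neg h0 h0]⟩
  have htend : Tendsto (fun j => ∑ l ∈ Finset.range j, zeroRun β l) atTop atTop :=
    tendsto_atTop_mono (le_sum_zeroRun hβ) tendsto_id
  refine liminf_le_of_frequently_le' (htend.frequently ?_)
  refine (h.and_eventually ((eventually_sum_zeroRun_le hβ hδ).and
    ((htend.eventually hpos).and (eventually_ge_atTop 2)))).mono ?_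
  rintro j ⟨hlt, hle, hp, hj⟩
  set N := ∑ l ∈ Finset.range j, zeroRun β l
  have hN : (2 : ℝ) ≤ N := by exact_mod_cast hj.trans (le_sum_zeroRun hβ j)
  have hlogN : 0 < Real.log N := Real.log_pos (by linarith)
  have hj0 : (0 : ℝ) < j + 2 := by positivity
  have hlogj : 0 < Real.log ((j : ℝ) + 2) :=
    Real.log_pos (by linarith [(Nat.cast_nonneg j : (0 : ℝ) ≤ j)])
  have h1 : Real.log ((betaT β)^[N] x) ≤ -Real.log (j + 2) := by
    rw [← Real.log_inv]
    exact Real.log_le_log hp (hlt.le.trans (inv_pow_zeroRun_le hβ j))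
  have h2 : Real.log N ≤ (1 + δ) * Real.log (j + 2) := by
    rw [← Real.log_rpow hj0]
    exact Real.log_le_log (by linarith) hle
  rw [logOrbitRatio, EReal.coe_le_coe_iff, div_le_iff₀ hlogN]
  refine h1.trans ?_
  rcases le_or_gt 0 z with h0 | h0
  · have := mul_nonneg h0 hlogN.le
    linarith
  · nlinarith [mul_le_mul_of_nonpos_left h2 h0.le, mul_le_mul_of_nonneg_right hδz hlogj.le]

lemma iterate_betaT_pos_of_infinite {β x : ℝ} (hx : x ∈ Set.Ico (0 : ℝ) 1)
    (h : HasInfiniteBetaExpansion β x) (n : ℕ) : 0 < (betaT β)^[n] x := by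
  refine lt_of_le_of_ne (iterate_betaT_mem_Ico β hx n).1 fun h0 => h ⟨n, fun m hm => ?_⟩
  have hz : (betaT β)^[m] x = 0 := by
    obtain ⟨i, rfl⟩ := Nat.exists_eq_add_of_le' hm
    rw [Function.iterate_add_apply, ← h0]
    exact Function.iterate_fixed (betaT_zero β) i
  simp [betaDigit, hz]

lemma logOrbitRatio_nonpos {β x : ℝ} (hx : x ∈ Set.Ico (0 : ℝ) 1) (n : ℕ) :
    logOrbitRatio β x n ≤ 0 := by
  have h := iterate_betaT_mem_Ico β hx n
  rw [logOrbitRatio, ← EReal.coe_zero, EReal.coe_le_coe_iff]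
  exact div_nonpos_of_nonpos_of_nonneg (Real.log_nonpos h.1 h.2.le) (Real.log_natCast_nonneg n)

lemma limsup_logOrbitRatio_eq_zero {β : ℝ} (hβ : 1 < β) {x : ℝ} (hx : x ∈ Set.Ico (0 : ℝ) 1)
    (h : HasInfiniteBetaExpansion β x) :
    limsup (fun n : ℕ => logOrbitRatio β x n) atTop = 0 := by
  have hβ0 : 0 < β := by linarith
  refine le_antisymm (limsup_le_of_le (by isBoundedDefault)
    (Eventually.of_forall (logOrbitRatio_nonpos hx))) ?_
  refine EReal.ge_of_forall_gt_iff_ge.1 fun z hz => ?_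
  have hz' : z < 0 := by exact_mod_cast hz
  have hfreq : ∃ᶠ n : ℕ in atTop, betaDigit β x n ≠ 0 := by
    rw [frequently_atTop]
    intro n
    by_contra! hn
    exact h ⟨n, hn⟩
  have hlim : Tendsto (fun n : ℕ => Real.log n) atTop atTop :=
    Real.tendsto_log_atTop.comp tendsto_natCast_atTop_atTop
  refine le_limsup_of_frequently_le' ?_
  refine (hfreq.and_eventually ((hlim.eventually_ge_atTop (Real.log β / -z)).and
    (hlim.eventually_gt_atTop 0))).mono ?_
  rintro n ⟨hd, hn, hn0⟩
  have hT := iterate_betaT_pos_of_infinite hx h n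
  have hge : 1 ≤ β * (betaT β)^[n] x := by
    by_contra! hlt
    exact hd (Int.floor_eq_zero_iff.2 ⟨by positivity, hlt⟩)
  have hlog : 0 ≤ Real.log β + Real.log ((betaT β)^[n] x) := by
    rw [← Real.log_mul hβ0.ne' hT.ne']
    exact Real.log_nonneg hge
  rw [div_le_iff₀ (by linarith)] at hn
  rw [logOrbitRatio, EReal.coe_le_coe_iff, le_div_iff₀ hn0]
  nlinarith

theorem mainTheorem8 (β : ℝ) (hβ : 1 < β) :
    (∀ᵐ x ∂(volume.restrict (Set.Ico (0 : ℝ) 1)),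
      liminf (fun n : ℕ => logOrbitRatio β x n) atTop = -1) ∧
    (∀ x ∈ Set.Ico (0 : ℝ) 1, HasInfiniteBetaExpansion β x →
      limsup (fun n : ℕ => logOrbitRatio β x n) atTop = 0) := by
  refine ⟨?_, fun x hx h => limsup_logOrbitRatio_eq_zero hβ hx h⟩
  have hlow : ∀ m : ℕ, ∀ᵐ x ∂(volume.restrict (Set.Ico (0 : ℝ) 1)), ∀ᶠ n : ℕ in atTop,
      (n : ℝ) ^ (-(1 + 1 / ((m : ℝ) + 1))) ≤ (betaT β)^[n] x := fun m =>
    ae_eventually_rpow_le_iterate_betaT hβ (lt_add_of_pos_right _ (by positivity))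
  filter_upwards [ae_all_iff.2 hlow,
    ae_frequently_iterate_betaT_lt hβ (not_summable_inv_pow_zeroRun hβ)] with x hx hx'
  refine le_antisymm (liminf_logOrbitRatio_le_neg_one hβ ?_ hx')
    (neg_one_le_liminf_logOrbitRatio hx)
  -- The bound `n⁻² ≤ T_βⁿ x` keeps the orbit positive, so the convention `log 0 = 0` does not
  -- interfere.
  filter_upwards [hx 0, eventually_gt_atTop 0] with n hn hn0
  have : (0 : ℝ) < n := by exact_mod_cast hn0
  exact lt_of_lt_of_le (by positivity) hn
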